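/- For a finite abelian group $G$ (written additively) and a set $A$ of non-zero integers, let $D_A(G)$ be the least positive integer $l$ such that every sequence $(x_1,\dots,x_l)$ in $G$ has a non-empty subsequence $(x_{i_1},\dots,x_{i_t})$ with $\sum_{j=1}^t a_j x_{i_j}=0$ for some $a_1,\dots,a_t\in A$ (repetitions among the $a_j$ allowed). For a prime $p$ and an integer $k\ge 2$, let $f^{(D)}(p,k)$ be the minimum of $|A|$ over all non-empty sets $A\subseteq\{1,\dots,p-1\}$ with $D_A(\mathbb{Z}/p\mathbb{Z})\le k$ (and $\infty$ if there is no such $A$). Theorem. For every integer $k\ge 2$ there are an integer $p_0=p_0(k)$ and a constant $C=C(k)>0$ such that, for every prime $p>p_0$, $f^{(D)}(p,k)$ is finite and $$p^{1/k}-1\;\le\; f^{(D)}(p,k)\;\le\; C\,(p\log p)^{1/k}.$$ -/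

import Mathlib

/-- Every `G`-sequence of length `l` has a non-empty subsequence (given by its set `I` of
positions) that has weights in `A` for which the weighted sum is zero. -/
def HasWeightedZeroSum (G : Type*) [AddCommGroup G] (A : Set ℤ) (l : ℕ) : Prop :=
  ∀ x : Fin l → G, ∃ I : Finset (Fin l), I.Nonempty ∧
    ∃ a : Fin l → ℤ, (∀ i ∈ I, a i ∈ A) ∧ ∑ i ∈ I, a i • x i = 0

/-- The weighted Davenport constant `D_A(G)`: the least positive integer `l` such that every
`G`-sequence of length `l` has a non-empty `A`-weighted zero-sum subsequence
(`⊤` if there is no such integer, as for `A = ∅`). -/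
noncomputable def weightedDavenport (G : Type*) [AddCommGroup G] (A : Set ℤ) : ℕ∞ :=
  sInf {d : ℕ∞ | ∃ l : ℕ, 0 < l ∧ HasWeightedZeroSum G A l ∧ d = (l : ℕ∞)}

/-- For a finite abelian group `G` of exponent `n`, the minimum size of a non-empty
`A ⊆ [1, n - 1]` with `D_A(G) ≤ k` (`⊤` if there is no such `A`). -/
noncomputable def minWeightSize (G : Type*) [AddCommGroup G] (k : ℕ) : ℕ∞ :=
  sInf {s : ℕ∞ | ∃ A : Finset ℤ, A.Nonempty ∧
    A ⊆ Finset.Icc 1 ((AddMonoid.exponent G : ℤ) - 1) ∧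
    weightedDavenport G (A : Set ℤ) ≤ (k : ℕ∞) ∧ s = (A.card : ℕ∞)}

/-!
The lower bound is a count of hyperplanes. If every sequence of length `l ≤ k` in `ℤ/p` has an
`A`-weighted zero-sum subsequence, then the hyperplanes `∑ aᵢ xᵢ = 0`, with `a ≠ 0` ranging over
`(A ∪ {0})ˡ`, cover `(ℤ/p)ˡ`. Each has `p ^ (l - 1)` points, so `p ≤ (|A| + 1) ^ l`
(`le_card_add_one_pow_of_hasWeightedZeroSum`).

For the upper bound, take `m ≈ 4 (k p log p) ^ (1 / k)` and build the weights as a union of `k`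
sets `A₁, …, A_k` of at most `m` residues, so that for *all* `x` with non-zero entries
simultaneously `0 ∈ x₁ A₁ + ⋯ + x_k A_k`. The set `A₁` is arbitrary, with non-zero elements, which
makes the weight vectors non-zero; zero weights may then be allowed elsewhere, as they only shorten
the subsequence. The other sets are random sets, derandomized one element at a time.

* For `1 < j < k`, the sum set `S` of the first `j - 1` terms has at most `m ^ (j - 1)` elements, and
  `T ⊆ S + x_j A_j` built so far has at most `p / 2`. A uniformly random translate of `S` has on
  average at least half of its elements outside `T`, so the average of `2 ^ (-|T| / |S|)` drops by a
  factor `3 / 4`. Hence some choice of `A_j` makes the sum of these potentials over all `x` at most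
  `p ^ k (3 / 4) ^ m`, and since `m` is much larger than `log p`, this forces
  `|S + x_j A_j| ≥ (m / 4) |S|` for every `x` (`exists_finset_forall_le_card_add_image`). Iterating,
  the sum set of `k - 1` terms has at least `(m / 4) ^ (k - 1)` elements
  (`exists_finset_large_weighted_sums`).
* A random element added to `A_k` represents `0` for a proportion `|S| / p` of the remaining `x`.
  So `m` elements can be chosen that leave at most
  `p ^ k (1 - (m / 4) ^ (k - 1) / p) ^ m < 1` of the `x` without a zero sum
  (`exists_finset_card_filter_zero_notMem_le`,
  `exists_finset_forall_weighted_sum_eq_zero`).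
-/

open Finset
open scoped Pointwise

/-! ### Growth and covering by random translates -/

/-- Averaging over dilates: a uniformly random translate `S + y * a` meets `T` in `#S * #T / #F`
elements on average. -/
lemma sum_card_filter_add_mul_mem {F : Type*} [Field F] [Fintype F] [DecidableEq F]
    (S T : Finset F) {y : F} (hy : y ≠ 0) :
    ∑ a : F, #{s ∈ S | s + y * a ∈ T} = #S * #T := by
  simp_rw [card_filter]
  rw [sum_comm, ← smul_eq_mul, ← sum_const]
  refine sum_congr rfl fun s _ => ?_
  rw [← card_filter]
  refine card_bij (fun a _ => s + y * a) (by simp) ?_ ?_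
  · intro a _ b _ h
    simpa [hy] using h
  · intro t ht
    refine ⟨y⁻¹ * (t - s), ?_, ?_⟩ <;> simp [hy, ht]

lemma two_rpow_neg_le {u : ℝ} (h0 : 0 ≤ u) (h1 : u ≤ 1) : (2 : ℝ) ^ (-u) ≤ 1 - u / 2 := by
  have := rpow_one_add_le_one_add_mul_self (s := -(1/2)) (by norm_num) h0 h1
  rw [Real.rpow_neg (by norm_num), ← Real.inv_rpow (by norm_num)]
  norm_num at this ⊢
  linarith

/-- The derandomized growth step: as long as the sets `S i + y i * A` fill at most half of the field,
one more element of `A` can be chosen so that the total potential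
`∑ i, 2 ^ (-#(S i + y i * A) / #(S i))` drops by the factor `3 / 4`. -/
lemma exists_finset_sum_two_rpow_le {F ι : Type*} [Field F] [Fintype F] [DecidableEq F] [Fintype ι]
    (S : ι → Finset F) (y : ι → F) (hS : ∀ i, (S i).Nonempty) (hy : ∀ i, y i ≠ 0) {m : ℕ}
    (hm : ∀ i, 2 * (#(S i) * m) ≤ Fintype.card F) :
    ∃ A : Finset F, #A ≤ m ∧
      ∑ i, (2 : ℝ) ^ (-(#(S i + A.image (y i * ·)) / #(S i) : ℝ)) ≤
        Fintype.card ι * (3 / 4 : ℝ) ^ m := by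
  suffices H : ∀ n ≤ m, ∃ A : Finset F, #A ≤ n ∧
      ∑ i, (2 : ℝ) ^ (-(#(S i + A.image (y i * ·)) / #(S i) : ℝ)) ≤
        Fintype.card ι * (3 / 4 : ℝ) ^ n from H m le_rfl
  intro n
  induction n with
  | zero => exact fun _ => ⟨∅, by simp⟩
  | succ n ih =>
    intro hn
    obtain ⟨A, hA, hsum⟩ := ih (by omega)
    have hq : (0 : ℝ) < Fintype.card F := by exact_mod_cast Fintype.card_pos
    obtain ⟨a, -, ha⟩ : ∃ a ∈ (univ : Finset F),
        ∑ i, (2 : ℝ) ^ (-(#(S i + (insert a A).image (y i * ·)) / #(S i) : ℝ)) ≤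
          Fintype.card ι * (3 / 4 : ℝ) ^ (n + 1) := by
      refine exists_le_of_sum_le univ_nonempty ?_
      rw [sum_comm, sum_const, nsmul_eq_mul, card_univ]
      calc _ ≤ ∑ i, (2 : ℝ) ^ (-(#(S i + A.image (y i * ·)) / #(S i) : ℝ)) *
              (3 / 4 * Fintype.card F) := by
            refine sum_le_sum fun i _ => ?_
            set T := S i + A.image (y i * ·) with hT
            have hs : (0 : ℝ) < #(S i) := by exact_mod_cast (hS i).card_pos
            have hTc : 2 * #T ≤ Fintype.card F := by
              refine le_trans ?_ (hm i)
              have : #T ≤ #(S i) * m := card_add_le.trans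
                (Nat.mul_le_mul_left _ (card_image_le.trans (by omega)))
              omega
            -- Elements of a translate of `S i` outside `T`, summed over all translates.
            have hnew : ∑ a : F, (#{s ∈ S i | s + y i * a ∈ Tᶜ} : ℝ) =
                #(S i) * (Fintype.card F - #T) := by
              have h := sum_card_filter_add_mul_mem (S i) Tᶜ (hy i)
              rw [card_compl] at h
              rw [← Nat.cast_sub (card_le_univ T)]
              exact_mod_cast h
            have hstep : ∀ a : F,
                (2 : ℝ) ^ (-(#(S i + (insert a A).image (y i * ·)) / #(S i) : ℝ)) ≤
                (2 : ℝ) ^ (-(#T / #(S i) : ℝ)) *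
                  (1 - #{s ∈ S i | s + y i * a ∈ Tᶜ} / #(S i) / 2) := by
              intro a
              set N := {s ∈ S i | s + y i * a ∈ Tᶜ} with hN
              have hle : #T + #N ≤ #(S i + (insert a A).image (y i * ·)) := by
                rw [← card_image_of_injective N (add_left_injective (y i * a)),
                  ← card_union_of_disjoint]
                · refine card_le_card (union_subset ?_ ?_)
                  · exact add_subset_add_left (image_subset_image (subset_insert _ _))
                  · intro t ht
                    obtain ⟨s, hs, rfl⟩ := mem_image.1 ht
                    exact add_mem_add (mem_filter.1 hs).1
                      (mem_image_of_mem _ (mem_insert_self _ _))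
                · rw [disjoint_right]
                  intro t ht
                  obtain ⟨s, hs, rfl⟩ := mem_image.1 ht
                  exact mem_compl.1 (mem_filter.1 hs).2
              calc _ ≤ (2 : ℝ) ^ (-(#T / #(S i) : ℝ) + -(#N / #(S i) : ℝ)) := by
                    refine Real.rpow_le_rpow_of_exponent_le (by norm_num) ?_
                    rw [← neg_add, ← add_div]
                    gcongr
                    exact_mod_cast hle
                _ = (2 : ℝ) ^ (-(#T / #(S i) : ℝ)) * (2 : ℝ) ^ (-(#N / #(S i) : ℝ)) :=
                    Real.rpow_add (by norm_num) _ _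
                _ ≤ _ := by
                    gcongr
                    refine two_rpow_neg_le (by positivity) ?_
                    rw [div_le_one hs]
                    exact_mod_cast card_filter_le _ _
            refine (sum_le_sum fun a _ => hstep a).trans ?_
            rw [← mul_sum, sum_sub_distrib, ← sum_div, ← sum_div, hnew]
            gcongr
            have hTc' : (2 : ℝ) * #T ≤ Fintype.card F := by exact_mod_cast hTc
            rw [mul_div_cancel_left₀ _ hs.ne']
            simp
            linarith
        _ ≤ Fintype.card F * (Fintype.card ι * (3 / 4 : ℝ) ^ (n + 1)) := by
            rw [← sum_mul, pow_succ]
            nlinarith [mul_le_mul_of_nonneg_right hsum (by positivity :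
              (0 : ℝ) ≤ 3 / 4 * Fintype.card F)]
    exact ⟨insert a A, (card_insert_le _ _).trans (by omega), ha⟩

/-- One set `A` of at most `m` elements enlarges all the sets `S i` by a factor of at least `m / 4`
under `S i ↦ S i + y i * A`, provided there are at most exponentially many (in `m`) of them. -/
lemma exists_finset_forall_le_card_add_image {F ι : Type*} [Field F] [Fintype F] [DecidableEq F]
    [Fintype ι] (S : ι → Finset F) (y : ι → F) (hS : ∀ i, (S i).Nonempty) (hy : ∀ i, y i ≠ 0)
    {m : ℕ} (hm : ∀ i, 2 * (#(S i) * m) ≤ Fintype.card F)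
    (hι : (Fintype.card ι : ℝ) ≤ (11 / 10) ^ m) :
    ∃ A : Finset F, #A ≤ m ∧ ∀ i, (m / 4 : ℝ) * #(S i) ≤ #(S i + A.image (y i * ·)) := by
  obtain ⟨A, hA, hsum⟩ := exists_finset_sum_two_rpow_le S y hS hy hm
  refine ⟨A, hA, fun i => ?_⟩
  have hs : (0 : ℝ) < #(S i) := by exact_mod_cast (hS i).card_pos
  have h1 : (2 : ℝ) ^ (-(#(S i + A.image (y i * ·)) / #(S i) : ℝ)) ≤ (2 : ℝ) ^ (-(m / 4 : ℝ)) := by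
    calc _ ≤ _ := single_le_sum (f := fun i =>
            (2 : ℝ) ^ (-(#(S i + A.image (y i * ·)) / #(S i) : ℝ)))
            (fun _ _ => by positivity) (mem_univ i)
      _ ≤ _ := hsum
      _ ≤ (11 / 10) ^ m * (3 / 4 : ℝ) ^ m := by gcongr
      -- `33 / 40 ≤ 2 ^ (-1 / 4)`, which is where the growth factor `m / 4` comes from.
      _ = (33 / 40 : ℝ) ^ m := by rw [← mul_pow]; norm_num
      _ ≤ ((2 : ℝ) ^ (-(1 / 4) : ℝ)) ^ m := by
          gcongr
          rw [← pow_le_pow_iff_left₀ (n := 4) (by norm_num) (by positivity) (by norm_num),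
            ← Real.rpow_mul_natCast (by norm_num)]
          norm_num [Real.rpow_neg_one]
      _ = _ := by
          rw [← Real.rpow_mul_natCast (by norm_num)]
          ring_nf
  rw [Real.rpow_le_rpow_left_iff (by norm_num), neg_le_neg_iff, le_div_iff₀ hs] at h1
  exact h1

/-- Greedy covering: `n` elements can be chosen one by one, each reducing the number of `i` with
`0 ∉ S i + y i * A` by the factor `1 - s / #F`. -/
lemma exists_finset_card_filter_zero_notMem_le {F ι : Type*} [Field F] [Fintype F] [DecidableEq F]
    [Fintype ι] (S : ι → Finset F) (y : ι → F) (hy : ∀ i, y i ≠ 0) {s : ℝ}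
    (hs : ∀ i, s ≤ #(S i)) (n : ℕ) (hs' : s ≤ Fintype.card F) :
    ∃ A : Finset F, #A ≤ n ∧ (#{i | 0 ∉ S i + A.image (y i * ·)} : ℝ) ≤
      Fintype.card ι * (1 - s / Fintype.card F) ^ n := by
  have hq : (0 : ℝ) < Fintype.card F := by exact_mod_cast Fintype.card_pos
  induction n with
  | zero => exact ⟨∅, by simp⟩
  | succ n ih =>
    obtain ⟨A, hA, hcard⟩ := ih
    set U : Finset ι := {i | 0 ∉ S i + A.image (y i * ·)} with hU
    obtain ⟨a, -, ha⟩ : ∃ a ∈ (univ : Finset F),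
        (#{i | 0 ∉ S i + (insert a A).image (y i * ·)} : ℝ) ≤
          Fintype.card ι * (1 - s / Fintype.card F) ^ (n + 1) := by
      refine exists_le_of_sum_le univ_nonempty ?_
      rw [sum_const, nsmul_eq_mul, card_univ]
      calc _ ≤ ∑ a : F, ∑ i ∈ U, (1 - #{t ∈ S i | t + y i * a ∈ ({0} : Finset F)} : ℝ) := by
            refine sum_le_sum fun a _ => ?_
            have hle : (#{i | 0 ∉ S i + (insert a A).image (y i * ·)} : ℝ) ≤
                ∑ i ∈ U, if 0 ∉ S i + (insert a A).image (y i * ·) then (1 : ℝ) else 0 := by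
              rw [← natCast_card_filter]
              norm_cast
              refine card_le_card fun i hi => ?_
              rw [mem_filter] at hi ⊢
              refine ⟨?_, hi.2⟩
              rw [hU, mem_filter]
              exact ⟨mem_univ _, fun h => hi.2
                (add_subset_add_left (image_subset_image (subset_insert _ _)) h)⟩
            refine hle.trans (sum_le_sum fun i _ => ?_)
            have hc : #{t ∈ S i | t + y i * a ∈ ({0} : Finset F)} ≤ 1 := by
              refine card_le_one.2 fun t ht t' ht' => ?_
              simp only [mem_filter, mem_singleton] at ht ht'
              exact add_right_cancel (ht.2.trans ht'.2.symm)
            split_ifs with h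
            · have : (#{t ∈ S i | t + y i * a ∈ ({0} : Finset F)} : ℝ) ≤ 1 := by exact_mod_cast hc
              linarith
            · rw [filter_false_of_mem]
              · simp
              · intro t ht h0
                exact h (mem_singleton.1 h0 ▸ add_mem_add ht
                  (mem_image_of_mem _ (mem_insert_self _ _)))
        _ = ∑ i ∈ U, (Fintype.card F - #(S i) : ℝ) := by
            rw [sum_comm]
            refine sum_congr rfl fun i _ => ?_
            have h := sum_card_filter_add_mul_mem (S i) {0} (hy i)
            rw [card_singleton, mul_one] at h
            rw [sum_sub_distrib, ← h]
            simp
        _ ≤ ∑ i ∈ U, (Fintype.card F - s : ℝ) := sum_le_sum fun i _ => by linarith [hs i]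
        _ = #U * (Fintype.card F - s) := by rw [sum_const, nsmul_eq_mul]
        _ ≤ (Fintype.card ι * (1 - s / Fintype.card F) ^ n) * (Fintype.card F - s) := by
            gcongr
        _ = _ := by
            rw [pow_succ]
            field_simp
    exact ⟨insert a A, (card_insert_le _ _).trans (by omega), ha⟩

/-! ### Sets of weights with a zero sum for every vector -/

lemma exists_snoc_weights {F : Type*} [Field F] [DecidableEq F] {j : ℕ} {A B : Finset F}
    {x : Fin (j + 1) → F} {a : Fin j → F} {b t : F} (ha : ∀ i, a i ∈ B) (ha0 : a ≠ 0) (hb : b ∈ A)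
    (hsum : ∑ i, a i * Fin.init x i = t) :
    ∃ a' : Fin (j + 1) → F, (∀ i, a' i ∈ B ∪ A) ∧ a' ≠ 0 ∧
      ∑ i, a' i * x i = t + x (Fin.last j) * b := by
  refine ⟨Fin.snoc a b, fun i => ?_, fun h => ha0 ?_, ?_⟩
  · refine Fin.lastCases ?_ (fun i => ?_) i
    · simp [hb]
    · simp [ha i]
  · ext i
    simpa using congrFun h i.castSucc
  · rw [Fin.sum_univ_castSucc, ← hsum]
    simp [Fin.init, mul_comm]

/-- The sets `S` consist of sums of `x` with non-zero weight vectors; they need not contain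
all of these sums. -/
lemma exists_finset_large_weighted_sums {F : Type*} [Field F] [Fintype F] [DecidableEq F]
    {k m : ℕ} (hm0 : 0 < m) (hm : 2 * m ^ (k - 1) ≤ Fintype.card F)
    (hF : (Fintype.card F : ℝ) ^ k ≤ (11 / 10) ^ m) (j : ℕ) (hj : 1 ≤ j) (hjk : j < k) :
    ∃ B : Finset F, #B ≤ j * m ∧ ∀ x : Fin j → F, (∀ i, x i ≠ 0) →
      ∃ S : Finset F, #S ≤ m ^ j ∧ (m / 4 : ℝ) ^ j ≤ #S ∧
        ∀ s ∈ S, ∃ a : Fin j → F, (∀ i, a i ∈ B) ∧ a ≠ 0 ∧ ∑ i, a i * x i = s := by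
  have hq : 1 < Fintype.card F := Fintype.one_lt_card
  induction j, hj using Nat.le_induction with
  | base =>
    -- Only here are zero weights excluded: this keeps the weight vector non-zero in later steps.
    have hmq : m ≤ #((univ : Finset F).erase 0) := by
      rw [card_erase_of_mem (mem_univ _), card_univ]
      have : m ≤ m ^ (k - 1) := Nat.le_self_pow (by omega) m
      omega
    obtain ⟨B, hB, hBm⟩ := exists_subset_card_eq hmq
    refine ⟨B, by omega, fun x hx => ⟨B.image (· * x 0), ?_, ?_, ?_⟩⟩
    · exact card_image_le.trans (by rw [hBm, pow_one])
    · rw [card_image_of_injective _ (mul_left_injective₀ (hx 0)), hBm, pow_one]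
      linarith [(Nat.cast_nonneg m : (0 : ℝ) ≤ m)]
    · intro s hs
      obtain ⟨b, hb, rfl⟩ := mem_image.1 hs
      refine ⟨fun _ => b, fun _ => hb, fun h => ?_, by simp⟩
      exact (mem_erase.1 (hB hb)).1 (congrFun h 0)
  | succ j hj ih =>
    obtain ⟨B, hB, hBS⟩ := ih (by omega)
    choose! S hS1 hS2 hS3 using hBS
    let ι := {x : Fin (j + 1) → F // ∀ i, x i ≠ 0}
    have hι : (Fintype.card ι : ℝ) ≤ (11 / 10) ^ m := by
      refine le_trans ?_ hF
      have h1 : Fintype.card ι ≤ Fintype.card F ^ (j + 1) := by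
        simpa using Fintype.card_subtype_le (fun x : Fin (j + 1) → F => ∀ i, x i ≠ 0)
      exact_mod_cast h1.trans (Nat.pow_le_pow_right (by omega) (by omega))
    have hne (z : ι) : ∀ i, Fin.init z.1 i ≠ 0 := fun i => z.2 _
    have hSne (z : ι) : (S (Fin.init z.1)).Nonempty := by
      have : (0 : ℝ) < #(S (Fin.init z.1)) :=
        (by positivity : (0 : ℝ) < (m / 4 : ℝ) ^ j).trans_le (hS2 _ (hne z))
      exact card_pos.1 (by exact_mod_cast this)
    have hScard (z : ι) : 2 * (#(S (Fin.init z.1)) * m) ≤ Fintype.card F := by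
      refine le_trans ?_ hm
      have h1 : #(S (Fin.init z.1)) * m ≤ m ^ (j + 1) := by
        rw [pow_succ]
        exact Nat.mul_le_mul_right _ (hS1 _ (hne z))
      have h2 : m ^ (j + 1) ≤ m ^ (k - 1) := Nat.pow_le_pow_right hm0 (by omega)
      omega
    obtain ⟨A, hA, hAS⟩ := exists_finset_forall_le_card_add_image
      (fun z : ι => S (Fin.init z.1)) (fun z => z.1 (Fin.last j)) hSne (fun z => z.2 _) hScard hι
    refine ⟨B ∪ A, ?_, fun x hx =>
      ⟨S (Fin.init x) + A.image (x (Fin.last j) * ·), ?_, ?_, ?_⟩⟩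
    · rw [add_mul, one_mul]
      exact (card_union_le _ _).trans (add_le_add hB hA)
    · rw [pow_succ]
      exact card_add_le.trans (Nat.mul_le_mul (hS1 _ (hne ⟨x, hx⟩)) (card_image_le.trans hA))
    · refine le_trans ?_ (hAS ⟨x, hx⟩)
      rw [pow_succ']
      gcongr
      exact hS2 _ (hne ⟨x, hx⟩)
    · intro s hs
      obtain ⟨t, ht, u, hu, rfl⟩ := mem_add.1 hs
      obtain ⟨b, hb, rfl⟩ := mem_image.1 hu
      obtain ⟨a, haB, ha0, hsum⟩ := hS3 _ (hne ⟨x, hx⟩) t ht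
      exact exists_snoc_weights haB ha0 hb hsum

lemma exists_finset_forall_weighted_sum_eq_zero {F : Type*} [Field F] [Fintype F] [DecidableEq F]
    {k m : ℕ} (hk : 2 ≤ k) (hm0 : 0 < m) (hm : 2 * m ^ (k - 1) ≤ Fintype.card F)
    (hF : (Fintype.card F : ℝ) ^ k ≤ (11 / 10) ^ m)
    (hm' : 4 ^ k * (k * (Fintype.card F * Real.log (Fintype.card F))) ≤ (m : ℝ) ^ k) :
    ∃ B : Finset F, #B ≤ k * m ∧ ∀ x : Fin k → F, (∀ i, x i ≠ 0) →
      ∃ a : Fin k → F, (∀ i, a i ∈ B) ∧ a ≠ 0 ∧ ∑ i, a i * x i = 0 := by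
  obtain ⟨k, rfl⟩ : ∃ n, k = n + 1 := ⟨k - 1, by omega⟩
  have hq : 1 < Fintype.card F := Fintype.one_lt_card
  have hq0 : (0 : ℝ) < Fintype.card F := by exact_mod_cast Fintype.card_pos
  have hlog : 0 < Real.log (Fintype.card F) := Real.log_pos (by exact_mod_cast hq)
  obtain ⟨B, hB, hBS⟩ := exists_finset_large_weighted_sums hm0 hm hF k (by omega) (by omega)
  choose! S hS1 hS2 hS3 using hBS
  let ι := {x : Fin (k + 1) → F // ∀ i, x i ≠ 0}
  have hι : (Fintype.card ι : ℝ) ≤ (Fintype.card F : ℝ) ^ (k + 1) := by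
    exact_mod_cast (by simpa using
      Fintype.card_subtype_le (fun x : Fin (k + 1) → F => ∀ i, x i ≠ 0) :
        Fintype.card ι ≤ Fintype.card F ^ (k + 1))
  have hne (z : ι) : ∀ i, Fin.init z.1 i ≠ 0 := fun i => z.2 _
  have hsq : (m / 4 : ℝ) ^ k ≤ Fintype.card F := by
    refine (hS2 (fun _ => 1) (fun _ => one_ne_zero)).trans ?_
    exact_mod_cast card_le_univ _
  obtain ⟨A, hA, hAS⟩ := exists_finset_card_filter_zero_notMem_le
    (fun z : ι => S (Fin.init z.1)) (fun z => z.1 (Fin.last k)) (fun z => z.2 _)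
    (fun z => hS2 _ (hne z)) m hsq
  set s : ℝ := (m / 4 : ℝ) ^ k
  have hlt : (Fintype.card ι : ℝ) * (1 - s / Fintype.card F) ^ m < 1 := by
    have h1 : (1 - s / Fintype.card F) ^ m ≤ Real.exp (-(m * (s / Fintype.card F))) := by
      rw [← mul_neg, Real.exp_nat_mul]
      refine pow_le_pow_left₀ ?_ (Real.one_sub_le_exp_neg _) m
      rw [sub_nonneg, div_le_one hq0]
      exact hsq
    have h2 : (Fintype.card F : ℝ) ^ (k + 1) =
        Real.exp ((k + 1 : ℕ) * Real.log (Fintype.card F)) := by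
      rw [Real.exp_nat_mul, Real.exp_log hq0]
    have h3 : 4 * ((k + 1 : ℕ) * Real.log (Fintype.card F)) ≤ m * (s / Fintype.card F) := by
      rw [← mul_div_assoc, le_div_iff₀ hq0]
      have : (m : ℝ) * s = 4 * (m ^ (k + 1) / 4 ^ (k + 1)) := by
        simp only [s]
        rw [div_pow, pow_succ (m : ℝ), pow_succ (4 : ℝ)]
        field_simp
      rw [this, mul_assoc]
      gcongr
      rw [le_div_iff₀ (by positivity)]
      linarith
    have h4 : (0 : ℝ) < (k + 1 : ℕ) * Real.log (Fintype.card F) := by positivity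
    calc _ ≤ Real.exp ((k + 1 : ℕ) * Real.log (Fintype.card F)) *
          Real.exp (-(m * (s / Fintype.card F))) := by
          rw [← h2]
          exact mul_le_mul hι h1 (pow_nonneg (sub_nonneg.2 ((div_le_one hq0).2 hsq)) m)
            (by positivity)
      _ < 1 := by
          rw [← Real.exp_add, Real.exp_lt_one_iff]
          linarith
  have hcard : #{z : ι | 0 ∉ S (Fin.init z.1) + A.image (z.1 (Fin.last k) * ·)} = 0 := by
    have := hAS.trans_lt hlt
    exact Nat.lt_one_iff.1 (by exact_mod_cast this)
  refine ⟨B ∪ A, ?_, fun x hx => ?_⟩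
  · rw [add_mul, one_mul]
    exact (card_union_le _ _).trans (add_le_add hB hA)
  · have h0 : 0 ∈ S (Fin.init x) + A.image (x (Fin.last k) * ·) := by
      simpa using (filter_eq_empty_iff.1 (card_eq_zero.1 hcard)) (mem_univ (⟨x, hx⟩ : ι))
    obtain ⟨t, ht, u, hu, h0⟩ := mem_add.1 h0
    obtain ⟨b, hb, rfl⟩ := mem_image.1 hu
    obtain ⟨a, haB, ha0, hsum⟩ := hS3 _ (hne ⟨x, hx⟩) t ht
    rw [← h0]
    exact exists_snoc_weights haB ha0 hb hsum

/-- The non-zero elements of `B`, represented by integers in `[1, p - 1]`, are weights as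
in the definition of `minWeightSize`. A zero entry of `x` is by itself a zero-sum subsequence. -/
lemma exists_weights_of_forall_weighted_sum_eq_zero {p k : ℕ} [Fact p.Prime] (hk : 0 < k)
    {B : Finset (ZMod p)} (hB : ∀ x : Fin k → ZMod p, (∀ i, x i ≠ 0) →
      ∃ a : Fin k → ZMod p, (∀ i, a i ∈ B) ∧ a ≠ 0 ∧ ∑ i, a i * x i = 0) :
    ∃ A : Finset ℤ, A.Nonempty ∧ A ⊆ Icc 1 ((p : ℤ) - 1) ∧
      weightedDavenport (ZMod p) (A : Set ℤ) ≤ k ∧ #A ≤ #B := by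
  have hmem {b : ZMod p} (hb : b ∈ B) (h0 : b ≠ 0) :
      (b.val : ℤ) ∈ (B.erase 0).image fun b : ZMod p => (b.val : ℤ) :=
    mem_image_of_mem _ (mem_erase.2 ⟨h0, hb⟩)
  have hne : ((B.erase 0).image fun b : ZMod p => (b.val : ℤ)).Nonempty := by
    obtain ⟨a, haB, ha0, -⟩ := hB (fun _ => 1) (fun _ => one_ne_zero)
    obtain ⟨i, hi⟩ := Function.ne_iff.1 ha0
    exact ⟨_, hmem (haB i) hi⟩
  refine ⟨(B.erase 0).image fun b => (b.val : ℤ), hne, ?_, ?_, ?_⟩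
  · intro z hz
    obtain ⟨b, hb, rfl⟩ := mem_image.1 hz
    have h1 := b.val_lt
    have h2 : b.val ≠ 0 := (ZMod.val_ne_zero b).2 (mem_erase.1 hb).1
    rw [mem_Icc]
    omega
  · refine sInf_le ⟨k, hk, fun x => ?_, rfl⟩
    by_cases hx : ∀ i, x i ≠ 0
    · obtain ⟨a, haB, ha0, hsum⟩ := hB x hx
      obtain ⟨i, hi⟩ := Function.ne_iff.1 ha0
      -- Positions with weight zero are left out of the subsequence.
      refine ⟨({i | a i ≠ 0} : Finset _), ⟨i, by simpa using hi⟩, fun i => ((a i).val : ℤ), ?_, ?_⟩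
      · intro i hi
        exact hmem (haB i) (mem_filter.1 hi).2
      · refine Eq.trans ?_ hsum
        rw [sum_filter]
        refine sum_congr rfl fun i _ => ?_
        split_ifs with h
        · simp [zsmul_eq_mul]
        · simp [not_not.1 h]
    · push Not at hx
      obtain ⟨i, hi⟩ := hx
      obtain ⟨z, hz⟩ := hne
      exact ⟨{i}, singleton_nonempty i, fun _ => z, fun _ _ => hz, by simp [hi]⟩
  · exact card_image_le.trans (card_erase_le)

/-! ### The lower bound: covering by hyperplanes -/

/-- A hyperplane in `(ℤ/p)ˡ` has at most `p ^ l / p` points: its translates in a coordinate direction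
with `a j ≠ 0` are disjoint. -/
lemma card_filter_sum_mul_eq_zero_le {p l : ℕ} [Fact p.Prime] {a : Fin l → ZMod p} (ha : a ≠ 0) :
    #{x : Fin l → ZMod p | ∑ i, a i * x i = 0} * p ≤ p ^ l := by
  obtain ⟨j, hj⟩ := Function.ne_iff.1 ha
  have h : #(({x : Fin l → ZMod p | ∑ i, a i * x i = 0} : Finset _) ×ˢ (univ : Finset (ZMod p))) ≤
      #(univ : Finset (Fin l → ZMod p)) := by
    refine card_le_card_of_injOn (fun z => z.1 + Pi.single j z.2) (by simp) ?_
    rintro ⟨x, t⟩ hx ⟨x', t'⟩ hx' h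
    simp only [coe_product, Set.mem_prod, mem_coe, mem_filter, mem_univ, true_and, and_true]
      at hx hx'
    have key := congrArg (fun z : Fin l → ZMod p => ∑ i, a i * z i) h
    simp only [Pi.add_apply, mul_add, sum_add_distrib, hx, hx', zero_add, Pi.single_apply, mul_ite,
      mul_zero, sum_ite_eq', mem_univ, if_true] at key
    obtain rfl := mul_left_cancel₀ hj key
    simpa using h
  simpa [card_product, ZMod.card] using h

lemma le_card_add_one_pow_of_hasWeightedZeroSum {p l : ℕ} [Fact p.Prime] {A : Finset ℤ}
    (hA : A ⊆ Icc 1 ((p : ℤ) - 1)) (h : HasWeightedZeroSum (ZMod p) (A : Set ℤ) l) :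
    p ≤ (#A + 1) ^ l := by
  classical
  have hp : 0 < p := (Fact.out : p.Prime).pos
  set V : Finset (Fin l → ZMod p) :=
    (Fintype.piFinset fun _ => insert 0 (A.image (Int.cast : ℤ → ZMod p))).erase 0 with hV
  have hcover : (univ : Finset (Fin l → ZMod p)) ⊆
      V.biUnion fun a => {x : Fin l → ZMod p | ∑ i, a i * x i = 0} := by
    intro x _
    obtain ⟨I, ⟨j, hj⟩, a, haA, hsum⟩ := h x
    refine mem_biUnion.2 ⟨fun i => if i ∈ I then (a i : ZMod p) else 0, ?_, ?_⟩
    · rw [hV, mem_erase]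
      refine ⟨fun h0 => ?_, ?_⟩
      · have h1 := congrFun h0 j
        simp only [hj, if_true, Pi.zero_apply] at h1
        rw [ZMod.intCast_zmod_eq_zero_iff_dvd] at h1
        have h2 := mem_Icc.1 (hA (haA j hj))
        have := Int.le_of_dvd (by omega) h1
        omega
      · rw [Fintype.mem_piFinset]
        intro i
        split_ifs with hi
        · exact mem_insert_of_mem (mem_image_of_mem _ (haA i hi))
        · exact mem_insert_self _ _
    · simp only [mem_filter, mem_univ, true_and, ite_mul, zero_mul, sum_ite_mem, univ_inter]
      simpa [zsmul_eq_mul] using hsum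
  have h1 : p ^ l ≤ ∑ a ∈ V, #{x : Fin l → ZMod p | ∑ i, a i * x i = 0} := by
    simpa [ZMod.card] using (card_le_card hcover).trans card_biUnion_le
  have h2 : p ^ l * p ≤ #V * p ^ l := by
    rw [← smul_eq_mul (#V), ← sum_const]
    refine (Nat.mul_le_mul_right p h1).trans ?_
    rw [sum_mul]
    exact sum_le_sum fun a ha => card_filter_sum_mul_eq_zero_le (mem_erase.1 ha).1
  have h3 : #V ≤ (#A + 1) ^ l := by
    refine (card_erase_le).trans ?_
    rw [Fintype.card_piFinset_const]
    gcongr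
    · exact (card_insert_le _ _).trans (by gcongr; exact card_image_le)
  refine le_trans ?_ h3
  rw [mul_comm] at h2
  exact Nat.le_of_mul_le_mul_right h2 (by positivity)

lemma rpow_sub_one_le_card {p k : ℕ} [Fact p.Prime] (hk : 2 ≤ k) {A : Finset ℤ}
    (hA : A ⊆ Icc 1 ((p : ℤ) - 1)) (h : weightedDavenport (ZMod p) (A : Set ℤ) ≤ k) :
    (p : ℝ) ^ (1 / (k : ℝ)) - 1 ≤ #A := by
  have hne : {d : ℕ∞ | ∃ l : ℕ, 0 < l ∧ HasWeightedZeroSum (ZMod p) (A : Set ℤ) l ∧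
      d = (l : ℕ∞)}.Nonempty := by
    by_contra hempty
    rw [weightedDavenport, Set.not_nonempty_iff_eq_empty.1 hempty, sInf_empty] at h
    exact absurd h (by simp)
  obtain ⟨l, -, hl, hle⟩ := csInf_mem hne
  rw [weightedDavenport, hle, Nat.cast_le] at h
  have h1 : p ≤ (#A + 1) ^ k :=
    (le_card_add_one_pow_of_hasWeightedZeroSum hA hl).trans (Nat.pow_le_pow_right (by omega) h)
  have h2 : (p : ℝ) ≤ ((#A : ℝ) + 1) ^ k := by exact_mod_cast h1
  have h3 := Real.rpow_le_rpow (by positivity) h2 (by positivity : 0 ≤ 1 / (k : ℝ))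
  rw [one_div, Real.pow_rpow_inv_natCast (by positivity) (by omega), ← one_div] at h3
  linarith

/-! ### The size of the weight set -/

open Filter in
/-- For large `p`, the size `m = ⌈4 (k p log p) ^ (1 / k)⌉` satisfies what the construction of the
weights needs. -/
lemma exists_growth_size (k : ℕ) (hk : 2 ≤ k) :
    ∃ p₀ : ℕ, ∀ p : ℕ, p₀ < p → ∃ m : ℕ, 2 * m ^ (k - 1) ≤ p ∧ (p : ℝ) ^ k ≤ (11 / 10) ^ m ∧
      4 ^ k * (k * (p * Real.log p)) ≤ (m : ℝ) ^ k ∧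
      (m : ℝ) ≤ 5 * (k * (p * Real.log p)) ^ (1 / (k : ℝ)) := by
  have hk0 : (0 : ℝ) < k := by positivity
  have hk1 : (2 : ℝ) ≤ k := by exact_mod_cast hk
  set c : ℝ := 2 * 5 ^ (k - 1) with hc
  have hc0 : 0 < c := by positivity
  have E1 : ∀ᶠ x : ℝ in atTop, c ^ k * k ^ (k - 1) * (Real.log x) ^ (k - 1) ≤ x := by
    have h := (Real.isLittleO_pow_log_id_atTop (n := k - 1)).bound
      (by positivity : 0 < (c ^ k * (k : ℝ) ^ (k - 1))⁻¹)
    filter_upwards [h, eventually_ge_atTop 1] with x hx hx1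
    have hl := Real.log_nonneg hx1
    rw [Real.norm_of_nonneg (by positivity), id, Real.norm_of_nonneg (by positivity)] at hx
    rwa [inv_mul_eq_div, le_div_iff₀' (by positivity)] at hx
  have E2 : ∀ᶠ x : ℝ in atTop, k * Real.log x ≤ 4 * x ^ (1 / (k : ℝ)) * Real.log (11 / 10) := by
    have hlog : 0 < Real.log (11 / 10) := Real.log_pos (by norm_num)
    have h := (isLittleO_log_rpow_atTop (by positivity : 0 < 1 / (k : ℝ))).bound
      (by positivity : 0 < 4 * Real.log (11 / 10) / k)
    filter_upwards [h, eventually_ge_atTop 1] with x hx hx1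
    have hl := Real.log_nonneg hx1
    rw [Real.norm_of_nonneg (by positivity), Real.norm_of_nonneg (by positivity)] at hx
    rw [div_mul_eq_mul_div, le_div_iff₀' hk0] at hx
    linarith
  obtain ⟨p₀, hp₀⟩ := eventually_atTop.1 (tendsto_natCast_atTop_atTop.eventually (E1.and E2))
  refine ⟨max p₀ 3, fun p hp => ?_⟩
  obtain ⟨h1, h2⟩ := hp₀ p (by omega)
  have hp3 : (3 : ℝ) ≤ p := by exact_mod_cast (by omega : 3 ≤ p)
  have hlog : 1 ≤ Real.log p := by
    rw [Real.le_log_iff_exp_le (by linarith)]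
    exact Real.exp_one_lt_d9.le.trans (by linarith)
  set f : ℝ := (k * (p * Real.log p)) ^ (1 / (k : ℝ)) with hf
  have hbase : (p : ℝ) ≤ k * (p * Real.log p) := by
    have : (p : ℝ) ≤ p * Real.log p := le_mul_of_one_le_right (by positivity) hlog
    nlinarith
  have hfk : f ^ k = k * (p * Real.log p) := by
    rw [hf, one_div, Real.rpow_inv_natCast_pow (by positivity) (by omega)]
  have hpf : (p : ℝ) ^ (1 / (k : ℝ)) ≤ f := Real.rpow_le_rpow (by positivity) hbase (by positivity)
  have hf1 : 1 ≤ f := (Real.one_le_rpow (by linarith) (by positivity)).trans hpf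
  have hm1 : 4 * f ≤ (⌈4 * f⌉₊ : ℝ) := Nat.le_ceil _
  have hm2 : (⌈4 * f⌉₊ : ℝ) ≤ 5 * f := by
    linarith [Nat.ceil_lt_add_one (by positivity : 0 ≤ 4 * f)]
  refine ⟨⌈4 * f⌉₊, ?_, ?_, ?_, hm2⟩
  · have hcf : c * f ^ (k - 1) ≤ p := by
      rw [← pow_le_pow_iff_left₀ (by positivity) (by positivity) (by omega : k ≠ 0), mul_pow,
        pow_right_comm, hfk]
      calc c ^ k * (k * (p * Real.log p)) ^ (k - 1)
          = (c ^ k * k ^ (k - 1) * (Real.log p) ^ (k - 1)) * p ^ (k - 1) := by ring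
        _ ≤ p * p ^ (k - 1) := by gcongr
        _ = p ^ k := by rw [← pow_succ', Nat.sub_add_cancel (by omega)]
    have : (2 : ℝ) * (⌈4 * f⌉₊ : ℝ) ^ (k - 1) ≤ p := by
      refine le_trans ?_ hcf
      rw [hc, mul_assoc, ← mul_pow]
      gcongr
    exact_mod_cast this
  · have hl : 0 < Real.log (11 / 10) := Real.log_pos (by norm_num)
    rw [← Real.log_le_log_iff (by positivity) (by positivity), Real.log_pow, Real.log_pow]
    refine h2.trans ?_
    gcongr
    linarith
  · rw [← hfk, ← mul_pow]
    gcongr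

theorem theorem1 (k : ℕ) (hk : 2 ≤ k) :
    ∃ p₀ : ℕ, ∃ C : ℝ, 0 < C ∧ ∀ p : ℕ, p.Prime → p₀ < p →
      ∃ m : ℕ, minWeightSize (ZMod p) k = (m : ℕ∞) ∧
        (p : ℝ) ^ (1 / (k : ℝ)) - 1 ≤ (m : ℝ) ∧
        (m : ℝ) ≤ C * ((p : ℝ) * Real.log (p : ℝ)) ^ (1 / (k : ℝ)) := by
  obtain ⟨p₀, hp₀⟩ := exists_growth_size k hk
  refine ⟨p₀, k * (5 * (k : ℝ) ^ (1 / (k : ℝ))), by positivity, fun p hp hlt => ?_⟩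
  have : Fact p.Prime := ⟨hp⟩
  obtain ⟨m, hm1, hm2, hm3, hm4⟩ := hp₀ p hlt
  have hlog : 0 < Real.log p := Real.log_pos (by exact_mod_cast hp.one_lt)
  have hp0 : (0 : ℝ) < p := by exact_mod_cast hp.pos
  have hm0 : 0 < m := by
    refine Nat.pos_of_ne_zero fun h => ?_
    rw [h, Nat.cast_zero, zero_pow (by omega)] at hm3
    exact absurd hm3 (not_le.2 (by positivity))
  obtain ⟨B, hB, hBx⟩ := exists_finset_forall_weighted_sum_eq_zero (F := ZMod p) hk hm0
    (by rwa [ZMod.card]) (by rwa [ZMod.card]) (by rwa [ZMod.card])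
  obtain ⟨A, hAne, hA1, hA2, hA3⟩ := exists_weights_of_forall_weighted_sum_eq_zero (by omega) hBx
  have hmem : (#A : ℕ∞) ∈ {s : ℕ∞ | ∃ A : Finset ℤ, A.Nonempty ∧
      A ⊆ Icc 1 ((AddMonoid.exponent (ZMod p) : ℤ) - 1) ∧
      weightedDavenport (ZMod p) (A : Set ℤ) ≤ (k : ℕ∞) ∧ s = (A.card : ℕ∞)} :=
    ⟨A, hAne, by rwa [ZMod.exponent], hA2, rfl⟩
  obtain ⟨A', -, hA'1, hA'2, hA'3⟩ := csInf_mem ⟨_, hmem⟩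
  rw [ZMod.exponent] at hA'1
  refine ⟨#A', hA'3, rpow_sub_one_le_card hk hA'1 hA'2, ?_⟩
  have hle : #A' ≤ #A := by
    have h := csInf_le (OrderBot.bddBelow _) hmem
    rw [hA'3] at h
    exact_mod_cast h
  calc (#A' : ℝ) ≤ (k * m : ℕ) := by exact_mod_cast hle.trans (hA3.trans hB)
    _ = k * (m : ℝ) := by push_cast; rfl
    _ ≤ k * (5 * (k * (p * Real.log p)) ^ (1 / (k : ℝ))) := by gcongr
    _ = _ := by
        rw [Real.mul_rpow (by positivity) (by positivity)]
        ring
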